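/- Let $E$ be a real Banach space with dual $E^*$ and bidual $E^{**}$, let $\langle x,x^*\rangle$ and $\langle x^*,x^{**}\rangle$ denote the canonical pairings, and let $\widehat{x}\in E^{**}$ denote the canonical image of $x\in E$, so that $\langle x^*,\widehat{x}\rangle=\langle x,x^*\rangle$. Let $S\colon E\rightrightarrows E^*$ be a multifunction with graph $G(S)=\{(x,x^*): x^*\in S(x)\}$. We say that $S$ is closed if $G(S)$ is norm-closed in $E\times E^*$, monotone if $\langle s-t,s^*-t^*\rangle\ge 0$ for all $(s,s^*),(t,t^*)\in G(S)$, and quasidense if, for all $(x,x^*)\in E\times E^*$, $$\inf_{(s,s^*)\in G(S)}\Big[\tfrac12\|s-x\|^2+\tfrac12\|s^*-x^*\|^2+\langle s-x,s^*-x^*\rangle\Big]\le 0,$$ where $\inf\emptyset=+\infty$. If $S$ is closed, monotone and quasidense, let $\varphi_S(x,x^*)=\sup_{(s,s^*)\in G(S)}\big[\langle s,x^*\rangle+\langle x,s^*\rangle-\langle s,s^*\rangle\big]$, and let $$\varphi_S^*(y^*,y^{**})=\sup_{(x,x^*)\in E\times E^*}\big[\langle x,y^*\rangle+\langle x^*,y^{**}\rangle-\varphi_S(x,x^*)\big].$$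 The Fitzpatrick extension of $S$ is the multifunction $S^{\mathbb F}\colon E^*\rightrightarrows E^{**}$ with graph $$G(S^{\mathbb F})=\{(y^*,y^{**})\in E^*\times E^{**}: \varphi_S^*(y^*,y^{**})=\langle y^*,y^{**}\rangle\}.$$ Let $K\subset E$ be nonempty, convex and compact in the weak topology $w(E,E^*)$, and put $\widehat{K}=\{\widehat{x}: x\in K\}$. Let $\mathbb I_K$ be the function equal to $0$ on $K$ and $+\infty$ on $E\setminus K$, with Fenchel conjugate $\mathbb I_K^*(x^*)=\sup_{x\in E}[\langle x,x^*\rangle-\mathbb I_K(x)]$, and let $\partial\mathbb I_K\colon E\rightrightarrows E^*$ be its subdifferential (the normal cone multifunction of $K$), defined by $x^*\in\partial\mathbb I_K(x)\iff \mathbb I_K(x)+\mathbb I_K^*(x^*)=\langle x,x^*\rangle$. Then $\partial\mathbb I_K$ is closed, monotone and quasidense, so that its Fitzpatrick extension $(\partial\mathbb I_K)^{\mathbb F}$ is defined, and for all $(y^*,y^{**})\in E^*\times E^{**}$, $$(y^*,y^{**})\in G\big((\partial\mathbb I_K)^{\mathbb F}\big)\iff y^{**}\in\widehat{K}\ \text{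 and }\ \langle y^*,y^{**}\rangle=\sup_{x\in K}\langle x,y^*\rangle .$$ -/

import Mathlib

noncomputable section

namespace FitzpatrickExt

/-- The graph `G(S)` of a multifunction `S : X ⇉ Y`. -/
def graph {X Y : Type*} (S : X → Set Y) : Set (X × Y) :=
  {p | p.2 ∈ S p.1}

section Normed

variable {X : Type*} [NormedAddCommGroup X] [NormedSpace ℝ X]

/-- The Fenchel conjugate `f*(x*) = sup_{x ∈ X} [⟨x, x*⟩ - f(x)]` on the dual of `X`. -/
def conjugate (f : X → EReal) (x' : StrongDual ℝ X) : EReal :=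
  ⨆ x : X, ((x' x : ℝ) : EReal) - f x

/-- The subdifferential: `x* ∈ ∂f(x)` iff `f(x) + f*(x*) = ⟨x, x*⟩`. -/
def subdifferential (f : X → EReal) (x : X) : Set (StrongDual ℝ X) :=
  {x' | f x + conjugate f x' = ((x' x : ℝ) : EReal)}

open Classical in
/-- The indicator function of `K`: `0` on `K` and `+∞` off `K`. -/
def indicatorFun (K : Set X) (x : X) : EReal :=
  if x ∈ K then 0 else ⊤

/-- The normal cone multifunction of `K`: the subdifferential of the indicator function of `K`. -/
def normalCone (K : Set X) : X → Set (StrongDual ℝ X) :=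
  subdifferential (indicatorFun K)

/-- `K` is compact in the weak topology `w(X, X*)`. -/
def IsWeaklyCompact (K : Set X) : Prop :=
  IsCompact (toWeakSpace ℝ X '' K)

/-- The multifunction `S : X ⇉ X*` is closed (for the norm topologies). -/
def ClosedMultifunction (S : X → Set (StrongDual ℝ X)) : Prop :=
  IsClosed (graph S)

/-- The multifunction `S : X ⇉ X*` is monotone. -/
def MonotoneMultifunction (S : X → Set (StrongDual ℝ X)) : Prop :=
  ∀ p ∈ graph S, ∀ q ∈ graph S, 0 ≤ (p.2 - q.2) (p.1 - q.1)

/-- The multifunction `S : X ⇉ X*` is quasidense. The infimum is taken in the extended reals. -/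
def Quasidense (S : X → Set (StrongDual ℝ X)) : Prop :=
  ∀ (x : X) (x' : StrongDual ℝ X),
    (⨅ p ∈ graph S,
      (((1 / 2 : ℝ) * ‖p.1 - x‖ ^ 2 + (1 / 2 : ℝ) * ‖p.2 - x'‖ ^ 2
        + (p.2 - x') (p.1 - x) : ℝ) : EReal)) ≤ 0

/-- The Fitzpatrick function
`φ_S(x, x*) = sup_{(s, s*) ∈ G(S)} [⟨s, x*⟩ + ⟨x, s*⟩ - ⟨s, s*⟩]`. -/
def fitzpatrickFunction (S : X → Set (StrongDual ℝ X)) (p : X × StrongDual ℝ X) : EReal :=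
  ⨆ s ∈ graph S, ((p.2 s.1 + s.2 p.1 - s.2 s.1 : ℝ) : EReal)

/-- The Fitzpatrick extension `S^F : X* ⇉ X**` of a closed, monotone, quasidense `S : X ⇉ X*`:
`y** ∈ S^F(y*)` iff `φ_S*(y*, y**) = ⟨y*, y**⟩`. A pair `(y*, y**)` is identified with the
functional `(x, x*) ↦ ⟨x, y*⟩ + ⟨x*, y**⟩` on `X × X*`, which is `y'.coprod y''`. -/
def fitzpatrickExtension (S : X → Set (StrongDual ℝ X)) (y' : StrongDual ℝ X) :
    Set (StrongDual ℝ (StrongDual ℝ X)) :=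
  {y'' | conjugate (fitzpatrickFunction S) (y'.coprod y'') = ((y'' y' : ℝ) : EReal)}

end Normed

end FitzpatrickExt

end

namespace FitzpatrickExt

variable {E : Type*} [NormedAddCommGroup E] [NormedSpace ℝ E] {K : Set E}

/-! Quasidensity is a minimisation: by weak compactness `½‖z - x‖² - x' z` attains its minimum over
`K` at some `s`, and the optimality condition there supplies a subgradient `p` for which `(s, x' -
p)` makes the bracket nonpositive. For the extension, `φ_S(x, x*) ≤ b` whenever `x ∈ K` and `x* ≤ b`
on `K`, so every `(y*, y**)` in it satisfies `⟨x, y*⟩ + ⟨x*, y**⟩ - b ≤ ⟨y*, y**⟩`. Scaling `(x*,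
b)` up forces `y**` below the support function of `K`, hence into the weak* compact convex image of
`K`; taking `x* = 0`, `b = 0` gives the support equality. The converse uses only monotonicity. -/

theorem mem_normalCone_iff (hne : K.Nonempty) {x : E} {x' : StrongDual ℝ E} :
    x' ∈ normalCone K x ↔ x ∈ K ∧ ∀ k ∈ K, x' k ≤ x' x := by
  have hconj : ∀ k ∈ K, ((x' k : ℝ) : EReal) ≤ conjugate (indicatorFun K) x' := fun k hk =>
    le_iSup_of_le k (by simp [indicatorFun, hk])
  change indicatorFun K x + conjugate (indicatorFun K) x' = ((x' x : ℝ) : EReal) ↔ _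
  constructor
  · intro h
    have hx : x ∈ K := by
      by_contra hx
      obtain ⟨k, hk⟩ := hne
      rw [indicatorFun, if_neg hx, EReal.top_add_of_ne_bot] at h
      · exact EReal.coe_ne_top _ h.symm
      · exact ne_bot_of_le_ne_bot (EReal.coe_ne_bot _) (hconj k hk)
    rw [indicatorFun, if_pos hx, zero_add] at h
    exact ⟨hx, fun k hk => EReal.coe_le_coe_iff.1 (h ▸ hconj k hk)⟩
  · rintro ⟨hx, h⟩
    rw [indicatorFun, if_pos hx, zero_add]
    refine le_antisymm (iSup_le fun k => ?_) (hconj x hx)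
    by_cases hk : k ∈ K
    · simpa [indicatorFun, hk] using h k hk
    · simp [indicatorFun, hk]

theorem mem_graph_normalCone_iff (hne : K.Nonempty) {p : E × StrongDual ℝ E} :
    p ∈ graph (normalCone K) ↔ p.1 ∈ K ∧ ∀ k ∈ K, p.2 k ≤ p.2 p.1 :=
  mem_normalCone_iff hne

/-- A convex weakly compact set is norm closed. -/
theorem IsWeaklyCompact.isClosed (hcpt : IsWeaklyCompact K) : IsClosed K := by
  have h := (IsCompact.isClosed hcpt).preimage (map_continuous (toWeakSpaceCLM ℝ E))
  rwa [show ⇑(toWeakSpaceCLM ℝ E) = toWeakSpace ℝ E from rfl,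
    Set.preimage_image_eq _ (toWeakSpace ℝ E).injective] at h

theorem closedMultifunction_normalCone (hne : K.Nonempty) (hK : IsClosed K) :
    ClosedMultifunction (normalCone K) := by
  have h : graph (normalCone K) =
      {p : E × StrongDual ℝ E | p.1 ∈ K} ∩ ⋂ k ∈ K, {p | p.2 k ≤ p.2 p.1} := by
    ext p
    simp [mem_graph_normalCone_iff hne]
  rw [ClosedMultifunction, h]
  refine (hK.preimage continuous_fst).inter (isClosed_biInter fun k _ => ?_)
  exact isClosed_le (by fun_prop) (by fun_prop)

theorem monotoneMultifunction_normalCone (hne : K.Nonempty) :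
    MonotoneMultifunction (normalCone K) := by
  intro p hp q hq
  obtain ⟨hpK, hp⟩ := (mem_graph_normalCone_iff hne).1 hp
  obtain ⟨hqK, hq⟩ := (mem_graph_normalCone_iff hne).1 hq
  have h1 := hp _ hqK
  have h2 := hq _ hpK
  simp only [sub_apply, map_sub]
  linarith

/-- A continuous convex function attains its infimum on a nonempty weakly compact set. -/
theorem IsWeaklyCompact.exists_forall_le (hcpt : IsWeaklyCompact K) (hne : K.Nonempty)
    {f : E → ℝ} (hf : ConvexOn ℝ Set.univ f) (hfc : Continuous f) :
    ∃ s ∈ K, ∀ k ∈ K, f s ≤ f k := by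
  have hlsc : LowerSemicontinuous fun w : WeakSpace ℝ E => f ((toWeakSpace ℝ E).symm w) := by
    rw [lowerSemicontinuous_iff_isClosed_preimage]
    intro c
    have hconv : Convex ℝ {x | f x ≤ c} := by simpa using hf.convex_le c
    have hcl : IsClosed {x | f x ≤ c} := isClosed_le hfc continuous_const
    -- Mazur: norm-closed convex sublevel sets are weakly closed.
    have h := hconv.toWeakSpace_closure ℝ
    rw [hcl.closure_eq, LinearEquiv.image_eq_preimage_symm] at h
    exact isClosed_of_closure_subset h.symm.subset
  obtain ⟨_, ⟨s, hs, rfl⟩, hmin⟩ :=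
    LowerSemicontinuousOn.exists_isMinOn (hne.image _) hcpt (hlsc.lowerSemicontinuousOn _)
  refine ⟨s, hs, fun k hk => ?_⟩
  simpa using hmin (Set.mem_image_of_mem _ hk)

theorem convexOn_half_norm_sub_sq (x : E) :
    ConvexOn ℝ Set.univ fun z => (1 / 2 : ℝ) * ‖z - x‖ ^ 2 := by
  have h : ConvexOn ℝ Set.univ fun z : E => ‖z - x‖ := by
    simpa [dist_eq_norm] using convexOn_univ_dist x
  simpa using (h.pow (fun z _ => norm_nonneg _) 2).smul (c := (1 / 2 : ℝ)) (by norm_num)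

/-- First-order optimality condition: at a minimiser over `K` of the sum of a continuous convex
function `h` and a linear functional, `h` has a subgradient certifying the minimality. -/
theorem exists_subgradient_of_isMin {h : E → ℝ} (hh : ConvexOn ℝ Set.univ h)
    (hhc : Continuous h) (hconv : Convex ℝ K) {x' : StrongDual ℝ E} {s : E} (hs : s ∈ K)
    (hmin : ∀ k ∈ K, h s - x' s ≤ h k - x' k) :
    ∃ p : StrongDual ℝ E, (∀ z, p z - h z ≤ p s - h s) ∧ ∀ k ∈ K, (x' - p) k ≤ (x' - p) s := by
  -- Separate the strict epigraph of `h` from the region over `K` below the affine function `h s +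
  -- x' (· - s)`; minimality at `s` makes them disjoint.
  have hA : Convex ℝ {q : E × ℝ | h q.1 < q.2} := by
    simpa using hh.convex_strict_epigraph
  have hAo : IsOpen {q : E × ℝ | h q.1 < q.2} :=
    isOpen_lt (hhc.comp continuous_fst) continuous_snd
  have hB : Convex ℝ {q : E × ℝ | q.1 ∈ K ∧ q.2 ≤ h s + x' (q.1 - s)} := by
    rintro ⟨a, r⟩ ⟨ha, hr⟩ ⟨b, t⟩ ⟨hb, ht⟩ u v hu hv huv
    refine ⟨hconv ha hb hu hv huv, ?_⟩
    simp only [map_sub, Prod.smul_mk, Prod.mk_add_mk, map_add, map_smul, smul_eq_mul] at *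
    have h1 := mul_le_mul_of_nonneg_left hr hu
    have h2 := mul_le_mul_of_nonneg_left ht hv
    obtain rfl : v = 1 - u := by linarith
    linarith
  have hdisj : Disjoint {q : E × ℝ | h q.1 < q.2}
      {q : E × ℝ | q.1 ∈ K ∧ q.2 ≤ h s + x' (q.1 - s)} := by
    rw [Set.disjoint_left]
    rintro ⟨a, r⟩ har ⟨haK, hr⟩
    have := hmin a haK
    simp only [Set.mem_ofPred_eq, map_sub] at *
    linarith
  obtain ⟨F, u, hF1, hF2⟩ := geometric_hahn_banach_open hA hAo hB hdisj
  set a : StrongDual ℝ E := F.comp (ContinuousLinearMap.inl ℝ E ℝ)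
  set α : ℝ := F (0, 1)
  have hF : ∀ z t, F (z, t) = a z + α * t := by
    intro z t
    have : (z, t) = (z, (0 : ℝ)) + t • ((0 : E), (1 : ℝ)) := by simp
    rw [this, map_add, map_smul, smul_eq_mul, mul_comm]
    rfl
  have hlow : ∀ k ∈ K, u ≤ a k + α * (h s + x' (k - s)) := fun k hk => by
    rw [← hF]
    exact hF2 _ ⟨hk, le_rfl⟩
  have hup : ∀ z, ∀ t, h z < t → a z + α * t < u := fun z t hzt => by
    rw [← hF]
    exact hF1 _ hzt
  have hs0 : u ≤ a s + α * h s := by simpa using hlow s hs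
  -- The hyperplane is not vertical, since the two sets contain `(s, h s + 1)` and `(s, h s)`.
  have hα0 : α < 0 := by
    have := hup s (h s + 1) (by linarith)
    linarith
  have hup' : ∀ z, a z + α * h z ≤ u := fun z => by
    refine le_of_forall_pos_lt_add fun ε hε => ?_
    have := hup z (h z + ε / (-α)) (by have := div_pos hε (neg_pos.2 hα0); linarith)
    have he : α * (ε / (-α)) = -ε := by rw [div_neg, mul_neg, mul_div_cancel₀ _ hα0.ne]
    linarith
  have hcancel : ∀ r : ℝ, (-α) * ((-α)⁻¹ * r) = r := fun r =>
    mul_inv_cancel_left₀ (neg_pos.2 hα0).ne' r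
  refine ⟨(-α)⁻¹ • a, fun z => ?_, fun k hk => ?_⟩
  · refine le_of_mul_le_mul_left ?_ (neg_pos.2 hα0)
    simp only [smul_apply, smul_eq_mul, mul_sub, hcancel]
    linarith [hup' z]
  · refine le_of_mul_le_mul_left ?_ (neg_pos.2 hα0)
    simp only [sub_apply, smul_apply, smul_eq_mul, mul_sub,
      hcancel]
    have h1 := hlow k hk
    have h2 := hup' s
    simp only [map_sub, mul_add, mul_sub] at h1
    linarith

/-- The conjugate of `½‖·‖²` is at least `½‖·‖²`. -/
theorem half_norm_sq_le_of_forall_le {p : StrongDual ℝ E} {c : ℝ}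
    (h : ∀ w, p w - (1 / 2 : ℝ) * ‖w‖ ^ 2 ≤ c) : (1 / 2 : ℝ) * ‖p‖ ^ 2 ≤ c := by
  have hc : 0 ≤ c := by simpa using h 0
  have hp : ‖p‖ ≤ √(2 * c) := by
    refine p.opNorm_le_bound (Real.sqrt_nonneg _) fun v => ?_
    rcases eq_or_ne v 0 with rfl | hv
    · simp
    have hv' : 0 < ‖v‖ := norm_pos_iff.2 hv
    -- This multiple of `v` maximises the left side of `h` along the line `ℝ v`.
    have h1 := h ((p v / ‖v‖ ^ 2) • v)
    rw [map_smul, norm_smul, smul_eq_mul, mul_pow, Real.norm_eq_abs, sq_abs] at h1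
    have h2 : p v / ‖v‖ ^ 2 * p v - 1 / 2 * ((p v / ‖v‖ ^ 2) ^ 2 * ‖v‖ ^ 2)
        = (p v) ^ 2 / (2 * ‖v‖ ^ 2) := by
      field_simp
      ring
    rw [h2, div_le_iff₀ (by positivity)] at h1
    refine abs_le_of_sq_le_sq ?_ (by positivity)
    rw [mul_pow, Real.sq_sqrt (by positivity)]
    linarith
  have := pow_le_pow_left₀ (norm_nonneg p) hp 2
  rw [Real.sq_sqrt (by positivity)] at this
  linarith

theorem quasidense_normalCone (hne : K.Nonempty) (hconv : Convex ℝ K) (hcpt : IsWeaklyCompact K) :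
    Quasidense (normalCone K) := by
  intro x x'
  have hh := convexOn_half_norm_sub_sq x
  have hhc : Continuous fun z : E => (1 / 2 : ℝ) * ‖z - x‖ ^ 2 := by fun_prop
  have hlin : ConvexOn ℝ Set.univ fun z => -x' z :=
    (-x').toLinearMap.convexOn convex_univ
  obtain ⟨s, hs, hmin⟩ := hcpt.exists_forall_le hne (hh.add hlin) (by fun_prop)
  obtain ⟨p, hp, hpK⟩ := exists_subgradient_of_isMin (x' := x') hh hhc hconv hs
    (by simpa [sub_eq_add_neg] using hmin)
  -- The subgradient inequality, recentred at `x`, bounds the conjugate of `½‖·‖²` at `p`.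
  have hpn : (1 / 2 : ℝ) * ‖p‖ ^ 2 ≤ p (s - x) - (1 / 2 : ℝ) * ‖s - x‖ ^ 2 := by
    refine half_norm_sq_le_of_forall_le fun w => ?_
    have := hp (w + x)
    simp only [map_add, add_sub_cancel_right, map_sub] at *
    linarith
  refine iInf₂_le_of_le (s, x' - p) ((mem_graph_normalCone_iff hne).2 ⟨hs, hpK⟩) ?_
  have hsub : x' - p - x' = -p := by abel
  rw [← EReal.coe_zero, EReal.coe_le_coe_iff]
  simp only [hsub, norm_neg, neg_apply]
  linarith

theorem fitzpatrickFunction_le_coe {S : E → Set (StrongDual ℝ E)} {p : E × StrongDual ℝ E} {c : ℝ}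
    (h : ∀ s ∈ graph S, p.2 s.1 + s.2 p.1 - s.2 s.1 ≤ c) :
    fitzpatrickFunction S p ≤ (c : EReal) :=
  iSup₂_le fun s hs => EReal.coe_le_coe_iff.2 (h s hs)

/-- The graph of a monotone multifunction, canonically embedded in `E* × E**`, lies in the graph of
its Fitzpatrick extension. -/
theorem MonotoneMultifunction.mem_fitzpatrickExtension {S : E → Set (StrongDual ℝ E)}
    (hS : MonotoneMultifunction S) {x : E} {x' : StrongDual ℝ E} (hx : (x, x') ∈ graph S) :
    NormedSpace.inclusionInDoubleDual ℝ E x ∈ fitzpatrickExtension S x' := by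
  -- The upper bound keeps only the term `(x, x')` of `φ_S`; monotonicity enters in the lower bound,
  -- as `φ_S(x, x') ≤ ⟨x, x'⟩`.
  refine le_antisymm (iSup_le fun q => ?_) (le_iSup_of_le (x, x') ?_)
  · have h : ((q.2 x + x' q.1 - x' x : ℝ) : EReal) ≤ fitzpatrickFunction S q :=
      le_iSup₂_of_le (x, x') hx le_rfl
    refine (EReal.sub_le_sub le_rfl h).trans ?_
    rw [← EReal.coe_sub, EReal.coe_le_coe_iff]
    simp
    linarith
  · have h : fitzpatrickFunction S (x, x') ≤ ((x' x : ℝ) : EReal) := by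
      refine fitzpatrickFunction_le_coe fun s hs => ?_
      have := hS _ hx s hs
      simp only [sub_apply, map_sub] at *
      linarith
    refine le_trans ?_ (EReal.sub_le_sub le_rfl h)
    rw [← EReal.coe_sub, EReal.coe_le_coe_iff]
    simp

theorem add_sub_le_of_mem_fitzpatrickExtension_normalCone (hne : K.Nonempty)
    {y' : StrongDual ℝ E} {y'' : StrongDual ℝ (StrongDual ℝ E)}
    (hy : y'' ∈ fitzpatrickExtension (normalCone K) y') {x : E} (hx : x ∈ K)
    {x' : StrongDual ℝ E} {b : ℝ} (hb : ∀ k ∈ K, x' k ≤ b) :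
    y' x + y'' x' - b ≤ y'' y' := by
  have h : fitzpatrickFunction (normalCone K) (x, x') ≤ (b : EReal) := by
    refine fitzpatrickFunction_le_coe fun s hs => ?_
    obtain ⟨hsK, hs⟩ := (mem_graph_normalCone_iff hne).1 hs
    linarith [hb _ hsK, hs x hx]
  have hle : ((y'.coprod y'' (x, x') : ℝ) : EReal) - b ≤ ((y'' y' : ℝ) : EReal) := by
    refine (EReal.sub_le_sub le_rfl h).trans ?_
    rw [← show conjugate _ _ = ((y'' y' : ℝ) : EReal) from hy]
    exact le_iSup (fun q => ((y'.coprod y'' q : ℝ) : EReal) - fitzpatrickFunction _ q) (x, x')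
  rw [← EReal.coe_sub, EReal.coe_le_coe_iff] at hle
  simpa using hle

/-- Separation of a point from a closed convex set in a weak topology `σ(V, W; B)`. -/
theorem exists_lt_of_notMem_weakBilin {V W : Type*} [AddCommGroup V] [Module ℝ V]
    [AddCommGroup W] [Module ℝ W] (B : V →ₗ[ℝ] W →ₗ[ℝ] ℝ) {s : Set (WeakBilin B)}
    (hs : Convex ℝ s) (hsc : IsClosed s) {y : WeakBilin B} (hy : y ∉ s) :
    ∃ (w : W) (b : ℝ), (∀ x ∈ s, WeakBilin.eval B w x < b) ∧ b < WeakBilin.eval B w y := by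
  obtain ⟨F, b, hFb, hbF⟩ := geometric_hahn_banach_closed_point hs hsc hy
  obtain ⟨w, rfl⟩ := B.dualEmbedding_surjective F
  exact ⟨w, b, hFb, hbF⟩

/-- An element of the bidual dominated by the support function of a nonempty weakly compact convex
set is the evaluation at a point of that set. -/
theorem IsWeaklyCompact.mem_image_inclusionInDoubleDual (hcpt : IsWeaklyCompact K)
    (hconv : Convex ℝ K) {y'' : StrongDual ℝ (StrongDual ℝ E)}
    (h : ∀ (x' : StrongDual ℝ E) (b : ℝ), (∀ k ∈ K, x' k ≤ b) → y'' x' ≤ b) :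
    y'' ∈ NormedSpace.inclusionInDoubleDual ℝ E '' K := by
  let B : StrongDual ℝ (StrongDual ℝ E) →ₗ[ℝ] StrongDual ℝ E →ₗ[ℝ] ℝ :=
    ContinuousLinearMap.coeLM ℝ
  let ι : WeakSpace ℝ E →ₗ[ℝ] WeakBilin B :=
    (NormedSpace.inclusionInDoubleDual ℝ E).toLinearMap ∘ₗ (toWeakSpace ℝ E).symm.toLinearMap
  have hι : Continuous ι := WeakBilin.continuous_of_continuous_eval B fun x' =>
    WeakBilin.eval_continuous (topDualPairing ℝ E).flip x'
  -- Hausdorffness turns the compact image of `K` into a closed set, as separation requires.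
  have hT2 : T2Space (WeakBilin B) :=
    (WeakBilin.isEmbedding (B := B) ContinuousLinearMap.coe_injective).t2Space
  have hL : IsCompact (ι '' (toWeakSpace ℝ E '' K)) := IsCompact.image hcpt hι
  have hLc : Convex ℝ (ι '' (toWeakSpace ℝ E '' K)) :=
    (hconv.linear_image (toWeakSpace ℝ E).toLinearMap).linear_image ι
  by_contra hy
  have hy' : (y'' : WeakBilin B) ∉ ι '' (toWeakSpace ℝ E '' K) := by
    rintro ⟨_, ⟨k, hk, rfl⟩, hk'⟩
    exact hy ⟨k, hk, hk'⟩
  obtain ⟨x', b, hlt, hgt⟩ := exists_lt_of_notMem_weakBilin B hLc hL.isClosed hy'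
  exact absurd (h x' b fun k hk => (hlt _ ⟨_, ⟨k, hk, rfl⟩, rfl⟩).le) (not_le.2 hgt)

end FitzpatrickExt

open FitzpatrickExt in
theorem mem_fitzpatrickExtension_normalCone_iff {E : Type*} [NormedAddCommGroup E]
    [NormedSpace ℝ E] {K : Set E} (hne : K.Nonempty) (hconv : Convex ℝ K)
    (hcpt : IsWeaklyCompact K) {y' : StrongDual ℝ E} {y'' : StrongDual ℝ (StrongDual ℝ E)} :
    y'' ∈ fitzpatrickExtension (normalCone K) y' ↔
      y'' ∈ NormedSpace.inclusionInDoubleDual ℝ E '' K ∧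
        ((y'' y' : ℝ) : EReal) = ⨆ x ∈ K, ((y' x : ℝ) : EReal) := by
  constructor
  · intro hy
    have hK : y'' ∈ NormedSpace.inclusionInDoubleDual ℝ E '' K := by
      refine hcpt.mem_image_inclusionInDoubleDual hconv fun x' b hb => ?_
      obtain ⟨x, hx⟩ := hne
      by_contra! hlt
      -- The `+ 1` makes the contradiction with the `n`-fold scaled inequality strict.
      obtain ⟨n, hn⟩ := Archimedean.arch (y'' y' - y' x + 1) (sub_pos.2 hlt)
      have h := add_sub_le_of_mem_fitzpatrickExtension_normalCone ⟨x, hx⟩ hy hx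
        (x' := (n : ℝ) • x') (b := n * b)
        (fun k hk => by simpa using mul_le_mul_of_nonneg_left (hb k hk) n.cast_nonneg)
      simp only [map_smul, smul_eq_mul, nsmul_eq_mul, mul_sub] at h hn
      linarith
    refine ⟨hK, ?_⟩
    obtain ⟨k, hk, rfl⟩ := hK
    refine le_antisymm (le_iSup₂_of_le k hk (by simp)) (iSup₂_le fun x hx => ?_)
    have h := add_sub_le_of_mem_fitzpatrickExtension_normalCone hne hy hx (x' := 0) (b := 0)
      (by simp)
    rw [EReal.coe_le_coe_iff]
    simpa using h
  · rintro ⟨⟨k, hk, rfl⟩, h⟩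
    refine (monotoneMultifunction_normalCone hne).mem_fitzpatrickExtension
      ((mem_graph_normalCone_iff hne).2 ⟨hk, fun x hx => ?_⟩)
    rw [NormedSpace.dual_def] at h
    rw [← EReal.coe_le_coe_iff, h]
    exact le_iSup₂_of_le x hx le_rfl

theorem mainTheorem11 {E : Type*} [NormedAddCommGroup E] [NormedSpace ℝ E] [CompleteSpace E]
    (K : Set E) (hne : K.Nonempty) (hconv : Convex ℝ K)
    (hcpt : FitzpatrickExt.IsWeaklyCompact K) :
    (FitzpatrickExt.ClosedMultifunction (FitzpatrickExt.normalCone K) ∧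
      FitzpatrickExt.MonotoneMultifunction (FitzpatrickExt.normalCone K) ∧
      FitzpatrickExt.Quasidense (FitzpatrickExt.normalCone K)) ∧
    ∀ (y' : StrongDual ℝ E) (y'' : StrongDual ℝ (StrongDual ℝ E)),
      (y', y'') ∈
          FitzpatrickExt.graph
            (FitzpatrickExt.fitzpatrickExtension (FitzpatrickExt.normalCone K)) ↔
        y'' ∈ NormedSpace.inclusionInDoubleDual ℝ E '' K ∧
          ((y'' y' : ℝ) : EReal) = ⨆ x ∈ K, ((y' x : ℝ) : EReal) := by
  exact ⟨⟨FitzpatrickExt.closedMultifunction_normalCone hne hcpt.isClosed,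
    FitzpatrickExt.monotoneMultifunction_normalCone hne,
    FitzpatrickExt.quasidense_normalCone hne hconv hcpt⟩,
    fun _ _ => mem_fitzpatrickExtension_normalCone_iff hne hconv hcpt⟩
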